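/- All complexes are finite abstract simplicial complexes; the empty set counts as a face, of dimension $-1$. $S_i(K)$ is the set of $i$-faces of $K$ (faces with $i+1$ vertices), and $F\in\partial \bar F$ means that $F$ arises from $\bar F$ by removing one vertex. $C^i(K,\mathbb R)$ is the space of real $i$-cochains, i.e. functions $f$ on oriented $i$-faces that change sign under reversal of the orientation, and $\delta_{i}:C^{i}(K,\mathbb R)\to C^{i+1}(K,\mathbb R)$ is the (augmented) coboundary map $(\delta_{i}f)([v_0,\dots,v_{i+1}])=\sum_{j}(-1)^jf([v_0,\dots,\hat v_j,\dots,v_{i+1}])$. For a positive weight $w$ on the faces of $K$, give $C^i(K,\mathbb R)$ the inner product $\langle f,g\rangle=\sum_{F\in S_i(K)}w(F)f([F])g([F])$; the $i$-down Laplace operator is $\delta_{i-1}\delta_{i-1}^*$ on $C^i(K,\mathbb R)$. For $w\equiv 1$ it is the combinatorial $i$-down Laplace operator $L_i^{\mathrm{down}}(K)$. If $w(F)=1$ for facets (maximal faces) $F$ and $w(F)=\sum_{\bar F:\,F\in\partial\bar F}w(\bar F)$ for all other faces, it is the normalized $i$-down Laplace operator $\Delta_i^{\mathrm{down}}(K)$.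 A covering map $\phi:K\to M$ is a simplicial map, with $K$ connected, such that for every face $G$ of $M$ the preimage $\phi^{-1}(G)$ (the subcomplex of the faces of $K$ mapped into $G$) is a union of pairwise disjoint simplices, each mapped bijectively onto $G$ by $\phi$. It is strong if, whenever $G\in\partial\bar G$ in $M$ and $F$ is a face of $K$ with $\phi(F)=G$, there is a face $\bar F$ of $K$ with $F\in\partial\bar F$ and $\phi(\bar F)=\bar G$. A strong covering is $k$-fold ($k\ge 1$) if every nonempty face of $M$ is the image of exactly $k$ faces of $K$. **Theorem.** Let $\phi:K\to M$ be a $k$-fold (strong) covering. Then, as multisets (eigenvalues counted with multiplicity), $$\operatorname{Spec}L_i^{\mathrm{down}}(M)\subset\operatorname{Spec}L_i^{\mathrm{down}}(K)\quad\text{for all } i\ge 1,\qquad \operatorname{Spec}\Delta_i^{\mathrm{down}}(M)\subset\operatorname{Spec}\Delta_i^{\mathrm{down}}(K)\quad\text{for all } i\ge 0 .$$ -/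

import Mathlib

/-! Finite abstract simplicial complexes are Mathlib's `AbstractSimplicialComplex V` with `V` finite;
`V` is the vertex set.  Mathlib's complexes list the nonempty faces only; the empty simplex is added
by `IsFace`.  Faces, cochains etc. are indexed by the number `n` of vertices, that is, by
`n = i + 1` for dimension `i ≥ -1`. -/

namespace AbstractSimplicialComplex

noncomputable section

/-- The faces of `K`, including the empty simplex. -/
def IsFace {V : Type*} (K : AbstractSimplicialComplex V) (F : Finset V) : Prop :=
  F = ∅ ∨ F ∈ K

theorem IsFace.mono {V : Type*} {K : AbstractSimplicialComplex V} {F G : Finset V}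
    (hG : K.IsFace G) (h : F ⊆ G) : K.IsFace F := by
  rcases F.eq_empty_or_nonempty with rfl | hF
  · exact Or.inl rfl
  · rcases hG with rfl | hG
    · exact Or.inl (Finset.subset_empty.mp h)
    · exact Or.inr ((K.isRelLowerSet_faces hG).2 h hF)

/-- `F ∈ ∂G`: the set `F` arises from `G` by removing one vertex. -/
def InBoundary {V : Type*} (F G : Finset V) : Prop :=
  F ⊆ G ∧ G.card = F.card + 1

/-- The faces with `n` vertices, i.e. the `(n - 1)`-faces. -/
def Face {V : Type*} (K : AbstractSimplicialComplex V) (n : ℕ) : Type _ :=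
  {F : Finset V // K.IsFace F ∧ F.card = n}

instance {V : Type*} [Finite V] (K : AbstractSimplicialComplex V) (n : ℕ) :
    Finite (K.Face n) :=
  inferInstanceAs (Finite {F : Finset V // K.IsFace F ∧ F.card = n})

instance {V : Type*} [Finite V] (K : AbstractSimplicialComplex V) (n : ℕ) :
    Fintype (K.Face n) :=
  Fintype.ofFinite _

/-! ### Cochains -/

/-- Faces with `n` vertices together with an ordering `v 0, …, v (n - 1)` of their vertices. -/
def OrderedFace {V : Type*} (K : AbstractSimplicialComplex V) (n : ℕ) : Type _ :=
  {v : Fin n ↪ V // K.IsFace (Finset.univ.map v)}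

instance {V : Type*} [Finite V] (K : AbstractSimplicialComplex V) (n : ℕ) :
    Finite (K.OrderedFace n) :=
  inferInstanceAs (Finite {v : Fin n ↪ V // K.IsFace (Finset.univ.map v)})

/-- The same face with its vertices reordered by `σ`. -/
def OrderedFace.perm {V : Type*} {K : AbstractSimplicialComplex V} {n : ℕ}
    (v : K.OrderedFace n) (σ : Equiv.Perm (Fin n)) : K.OrderedFace n :=
  ⟨σ.toEmbedding.trans v.1, v.2.mono (by
    intro x hx
    simp only [Finset.mem_map, Finset.mem_univ, true_and] at hx ⊢
    obtain ⟨a, rfl⟩ := hx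
    exact ⟨σ a, rfl⟩)⟩

/-- The ordered face `[v₀, …, v̂ⱼ, …, vₙ]`. -/
def OrderedFace.dropVertex {V : Type*} {K : AbstractSimplicialComplex V} {n : ℕ}
    (v : K.OrderedFace (n + 1)) (j : Fin (n + 1)) : K.OrderedFace n :=
  ⟨(Fin.succAboveEmb j).trans v.1, v.2.mono (by
    intro x hx
    simp only [Finset.mem_map, Finset.mem_univ, true_and] at hx ⊢
    obtain ⟨a, rfl⟩ := hx
    exact ⟨j.succAbove a, rfl⟩)⟩

/-- A chosen ordering of the vertices of a face. -/
def Face.ordering {V : Type*} {K : AbstractSimplicialComplex V} {n : ℕ} (F : K.Face n) :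
    K.OrderedFace n :=
  ⟨(F.1.equivFinOfCardEq F.2.2).symm.toEmbedding.trans (Function.Embedding.subtype _),
    F.2.1.mono (by
      intro x hx
      simp only [Finset.mem_map, Finset.mem_univ, true_and] at hx
      obtain ⟨a, rfl⟩ := hx
      exact ((F.1.equivFinOfCardEq F.2.2).symm a).2)⟩

/-- Real cochains on the faces with `n` vertices, i.e. the linear dual of the space generated by
the oriented faces modulo `[F₁] + [F₂] = 0` for opposite orientations of one face: functions on
ordered faces that change by the sign of the permutation when the vertices are reordered. -/
def Cochain {V : Type*} (K : AbstractSimplicialComplex V) (n : ℕ) :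
    Submodule ℝ (K.OrderedFace n → ℝ) where
  carrier := {f | ∀ (v : K.OrderedFace n) (σ : Equiv.Perm (Fin n)),
    f (v.perm σ) = ((Equiv.Perm.sign σ : ℤ) : ℝ) * f v}
  add_mem' := by
    intro f g hf hg v σ
    simp only [Pi.add_apply, hf v σ, hg v σ]
    ring
  zero_mem' := by
    intro v σ
    simp
  smul_mem' := by
    intro c f hf v σ
    simp only [Pi.smul_apply, smul_eq_mul, hf v σ]
    ring

theorem exists_perm_dropVertex {V : Type*} {K : AbstractSimplicialComplex V} {n : ℕ}
    (v : K.OrderedFace (n + 1)) (σ : Equiv.Perm (Fin (n + 1))) (j : Fin (n + 1)) :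
    ∃ τ : Equiv.Perm (Fin n), (v.perm σ).dropVertex j = (v.dropVertex (σ j)).perm τ ∧
      (-1 : ℝ) ^ (j : ℕ) * ((Equiv.Perm.sign τ : ℤ) : ℝ) =
        ((Equiv.Perm.sign σ : ℤ) : ℝ) * (-1 : ℝ) ^ ((σ j : Fin (n + 1)) : ℕ) := by
  set ρ : Equiv.Perm (Fin (n + 1)) := (σ j).cycleRange * σ * (j.cycleRange)⁻¹ with hρ
  have h0 : ρ 0 = 0 := by
    simp [hρ, Equiv.Perm.mul_apply, Equiv.Perm.inv_def]
  obtain ⟨⟨p, τ⟩, hpτ⟩ := (Equiv.Perm.decomposeFin (n := n)).symm.surjective ρ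
  have hp : p = 0 := by
    have := Equiv.Perm.decomposeFin_symm_apply_zero p τ
    rw [hpτ, h0] at this
    exact this.symm
  subst hp
  refine ⟨τ, ?_, ?_⟩
  · apply Subtype.ext
    ext k
    change v.1 (σ (j.succAbove k)) = v.1 ((σ j).succAbove (τ k))
    congr 1
    have h1 : ρ k.succ = (τ k).succ := by
      rw [← hpτ]
      simp
    apply (σ j).cycleRange.injective
    rw [Fin.cycleRange_succAbove, ← h1]
    simp [hρ, Equiv.Perm.mul_apply, Equiv.Perm.inv_def]
  · have h2 : Equiv.Perm.sign ρ = Equiv.Perm.sign τ := by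
      rw [← hpτ]
      simp
    have h3 : Equiv.Perm.sign τ =
        (-1) ^ ((σ j : Fin (n + 1)) : ℕ) * Equiv.Perm.sign σ * (-1) ^ (j : ℕ) := by
      rw [← h2, hρ]
      simp [Fin.sign_cycleRange]
    rw [h3]
    push_cast
    have h4 : (-1 : ℝ) ^ (j : ℕ) * (-1 : ℝ) ^ (j : ℕ) = 1 := by
      rw [← mul_pow]; simp
    linear_combination ((-1 : ℝ) ^ ((σ j : Fin (n + 1)) : ℕ) *
      ((Equiv.Perm.sign σ : ℤ) : ℝ)) * h4

/-- The coboundary `(δ f)([v₀, …, vₙ]) = ∑ⱼ (-1)ʲ f([v₀, …, v̂ⱼ, …, vₙ])`. -/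
def coboundary {V : Type*} (K : AbstractSimplicialComplex V) (n : ℕ) :
    K.Cochain n →ₗ[ℝ] K.Cochain (n + 1) where
  toFun f := ⟨fun v => ∑ j : Fin (n + 1), (-1 : ℝ) ^ (j : ℕ) * f.1 (v.dropVertex j), by
    intro v σ
    rw [Finset.mul_sum, ← Equiv.sum_comp σ]
    refine Finset.sum_congr rfl fun j _ => ?_
    obtain ⟨τ, h1, h2⟩ := exists_perm_dropVertex v σ j
    rw [h1, f.2 _ τ, ← mul_assoc, h2, mul_assoc]⟩
  map_add' f g := by
    apply Subtype.ext
    funext v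
    simp [mul_add, Finset.sum_add_distrib]
  map_smul' c f := by
    apply Subtype.ext
    funext v
    simp only [SetLike.val_smul, Pi.smul_apply, smul_eq_mul, RingHom.id_apply, Finset.mul_sum]
    exact Finset.sum_congr rfl fun j _ => by ring

/-! ### Weights, inner products and Laplace operators -/

/-- A weight function: it is positive on all faces, including the empty one. -/
structure FaceWeight {V : Type*} (K : AbstractSimplicialComplex V) where
  toFun : Finset V → ℝ
  pos : ∀ F, K.IsFace F → 0 < toFun F

theorem exists_ordering_perm {V : Type*} {K : AbstractSimplicialComplex V} {n : ℕ}
    (v : K.OrderedFace n) :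
    ∃ (F : K.Face n) (σ : Equiv.Perm (Fin n)), v = F.ordering.perm σ := by
  let F : K.Face n := ⟨Finset.univ.map v.1, v.2, by simp⟩
  let e := F.1.equivFinOfCardEq F.2.2
  have hmem : ∀ a, v.1 a ∈ F.1 := fun a => Finset.mem_map_of_mem _ (Finset.mem_univ a)
  let s : Fin n → Fin n := fun a => e ⟨v.1 a, hmem a⟩
  have hs : Function.Injective s := fun a b h => by
    have := e.injective h
    exact v.1.injective (congrArg Subtype.val this)
  refine ⟨F, Equiv.ofBijective s (Finite.injective_iff_bijective.mp hs), ?_⟩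
  apply Subtype.ext
  ext a
  change v.1 a = (e.symm (e ⟨v.1 a, hmem a⟩)).1
  simp

/-- The cochain space of `K`, to be equipped with the inner product given by the weight `w`. -/
def WCochain {V : Type*} {K : AbstractSimplicialComplex V} (_w : K.FaceWeight) (n : ℕ) : Type _ :=
  K.Cochain n

instance {V : Type*} {K : AbstractSimplicialComplex V} (w : K.FaceWeight) (n : ℕ) :
    AddCommGroup (WCochain w n) :=
  inferInstanceAs (AddCommGroup (K.Cochain n))

instance {V : Type*} {K : AbstractSimplicialComplex V} (w : K.FaceWeight) (n : ℕ) :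
    Module ℝ (WCochain w n) :=
  inferInstanceAs (Module ℝ (K.Cochain n))

instance {V : Type*} [Finite V] {K : AbstractSimplicialComplex V} (w : K.FaceWeight) (n : ℕ) :
    FiniteDimensional ℝ (WCochain w n) :=
  inferInstanceAs (FiniteDimensional ℝ (K.Cochain n))

/-- The inner product `⟪f, g⟫ = ∑_F w(F) f([F]) g([F])`, the sum over all faces with `n` vertices;
the terms do not depend on the chosen orientations. -/
abbrev innerCore {V : Type*} [Finite V] {K : AbstractSimplicialComplex V}
    (w : K.FaceWeight) (n : ℕ) : InnerProductSpace.Core ℝ (WCochain w n) where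
  inner f g := ∑ F : K.Face n, w.toFun F.1 * f.1 F.ordering * g.1 F.ordering
  conj_inner_symm f g := by
    simp only [conj_trivial]
    exact Finset.sum_congr rfl fun F _ => by ring
  re_inner_nonneg f := by
    simp only [RCLike.re_to_real]
    refine Finset.sum_nonneg fun F _ => ?_
    rw [mul_assoc]
    exact mul_nonneg (w.pos _ F.2.1).le (mul_self_nonneg _)
  add_left f g h := by
    rw [← Finset.sum_add_distrib]
    refine Finset.sum_congr rfl fun F _ => ?_
    change w.toFun F.1 * (f.1 F.ordering + g.1 F.ordering) * h.1 F.ordering = _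
    ring
  smul_left f g r := by
    simp only [conj_trivial]
    rw [Finset.mul_sum]
    refine Finset.sum_congr rfl fun F _ => ?_
    change w.toFun F.1 * (r * f.1 F.ordering) * g.1 F.ordering = _
    ring
  definite f hf := by
    have hz : ∀ F : K.Face n, f.1 F.ordering = 0 := by
      intro F
      have hnn : ∀ G ∈ (Finset.univ : Finset (K.Face n)),
          0 ≤ w.toFun G.1 * f.1 G.ordering * f.1 G.ordering := fun G _ => by
        rw [mul_assoc]
        exact mul_nonneg (w.pos _ G.2.1).le (mul_self_nonneg _)
      have h := (Finset.sum_eq_zero_iff_of_nonneg hnn).mp hf F (Finset.mem_univ F)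
      rw [mul_assoc] at h
      rcases mul_eq_zero.mp h with h | h
      · exact absurd h (w.pos _ F.2.1).ne'
      · exact mul_self_eq_zero.mp h
    apply Subtype.ext
    funext v
    obtain ⟨F, σ, rfl⟩ := exists_ordering_perm v
    rw [f.2 F.ordering σ, hz F, mul_zero]
    rfl

instance {V : Type*} [Finite V] {K : AbstractSimplicialComplex V} (w : K.FaceWeight) (n : ℕ) :
    NormedAddCommGroup (WCochain w n) :=
  (innerCore w n).toNormedAddCommGroup

instance {V : Type*} [Finite V] {K : AbstractSimplicialComplex V} (w : K.FaceWeight) (n : ℕ) :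
    InnerProductSpace ℝ (WCochain w n) :=
  InnerProductSpace.ofCore (innerCore w n).toCore

/-- The coboundary as a map of weighted cochain spaces. -/
def wCoboundary {V : Type*} [Finite V] {K : AbstractSimplicialComplex V} (w : K.FaceWeight)
    (n : ℕ) : WCochain w n →ₗ[ℝ] WCochain w (n + 1) :=
  K.coboundary n

/-- The `i`-down Laplace operator `δᵢ₋₁ δᵢ₋₁*` on the `i`-cochains (`i ≥ 0`), with respect to the
weight `w`. -/
def downLaplacian {V : Type*} [Finite V] {K : AbstractSimplicialComplex V} (w : K.FaceWeight)
    (i : ℕ) : WCochain w (i + 1) →ₗ[ℝ] WCochain w (i + 1) :=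
  wCoboundary w i ∘ₗ LinearMap.adjoint (wCoboundary w i)

/-- The weight that is identically `1`. -/
def unitWeight {V : Type*} (K : AbstractSimplicialComplex V) : K.FaceWeight where
  toFun _ := 1
  pos _ _ := one_pos

open Classical in
/-- The normalized weight: `w(F) = 1` if `F` is a facet (a maximal face), and otherwise `w(F)` is
the sum of `w(G)` over all faces `G` with `F ∈ ∂G`. -/
def normalizedWeightFun {V : Type*} [Fintype V] (K : AbstractSimplicialComplex V)
    (F : Finset V) : ℝ :=
  if Maximal K.IsFace F then 1
  else ∑ G ∈ (Finset.univ.filter fun G => K.IsFace G ∧ InBoundary F G).attach,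
    normalizedWeightFun K G.1
termination_by Fintype.card V - F.card
decreasing_by
  have h := (Finset.mem_filter.mp G.2).2.2.2
  have h' := Finset.card_le_univ G.1
  omega

theorem normalizedWeightFun_pos {V : Type*} [Fintype V] (K : AbstractSimplicialComplex V)
    (F : Finset V) (hF : K.IsFace F) : 0 < normalizedWeightFun K F := by
  classical
  induction hm : Fintype.card V - F.card using Nat.strong_induction_on generalizing F with
  | _ m ih =>
    rw [normalizedWeightFun]
    split_ifs with h
    · exact one_pos
    · refine Finset.sum_pos (fun G _ => ?_) ?_
      · have hG := (Finset.mem_filter.mp G.2).2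
        have h1 := hG.2.2
        have h2 := Finset.card_le_univ G.1
        exact ih _ (by omega) G.1 hG.1 rfl
      · rw [Finset.attach_nonempty_iff]
        rw [not_maximal_iff hF] at h
        obtain ⟨G, hG, hlt⟩ := h
        obtain ⟨x, hxG, hxF⟩ := Finset.exists_of_ssubset hlt
        refine ⟨insert x F, Finset.mem_filter.mpr ⟨Finset.mem_univ _, hG.mono ?_,
          Finset.subset_insert _ _, Finset.card_insert_of_notMem hxF⟩⟩
        exact Finset.insert_subset hxG hlt.1

def normalizedWeight {V : Type*} [Fintype V] (K : AbstractSimplicialComplex V) :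
    K.FaceWeight where
  toFun := normalizedWeightFun K
  pos := normalizedWeightFun_pos K

/-- The combinatorial `i`-down Laplace operator. -/
def combDownLaplacian {V : Type*} [Finite V] (K : AbstractSimplicialComplex V) (i : ℕ) :
    WCochain (unitWeight K) (i + 1) →ₗ[ℝ] WCochain (unitWeight K) (i + 1) :=
  downLaplacian (unitWeight K) i

/-- The normalized `i`-down Laplace operator. -/
def normDownLaplacian {V : Type*} [Fintype V] (K : AbstractSimplicialComplex V) (i : ℕ) :
    WCochain (normalizedWeight K) (i + 1) →ₗ[ℝ] WCochain (normalizedWeight K) (i + 1) :=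
  downLaplacian (normalizedWeight K) i

/-- The spectrum of a linear operator on a finite-dimensional real space, as a multiset: all complex
roots of the characteristic polynomial, with multiplicities. -/
def multisetSpectrum {E : Type*} [AddCommGroup E] [Module ℝ E] [FiniteDimensional ℝ E]
    (T : E →ₗ[ℝ] E) : Multiset ℂ :=
  T.charpoly.aroots ℂ

/-! ### Coverings -/

/-- The graph of vertices and edges. -/
def oneSkeleton {V : Type*} [DecidableEq V] (K : AbstractSimplicialComplex V) :
    SimpleGraph V where
  Adj u v := u ≠ v ∧ ({u, v} : Finset V) ∈ K
  symm := ⟨fun u v h => ⟨h.1.symm, by rw [Finset.pair_comm]; exact h.2⟩⟩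
  loopless := ⟨fun _ h => h.1 rfl⟩

/-- Connected: any two vertices are joined by a path of edges. -/
def IsConnected {V : Type*} [DecidableEq V] (K : AbstractSimplicialComplex V) : Prop :=
  K.oneSkeleton.Preconnected

/-- Simplicial maps, given on vertices. -/
def IsSimplicialMap {V W : Type*} [DecidableEq W] (K : AbstractSimplicialComplex V)
    (M : AbstractSimplicialComplex W) (φ : V → W) : Prop :=
  ∀ F, K.IsFace F → M.IsFace (F.image φ)

/-- The faces of `K` lying over the face `G` of the base. -/
def facesOver {V W : Type*} [DecidableEq W] (K : AbstractSimplicialComplex V) (φ : V → W)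
    (G : Finset W) : Set (Finset V) :=
  {F | K.IsFace F ∧ F.image φ = G}

/-- Covering maps.  In `preimage`, `φ⁻¹(G)` is the subcomplex of all faces of `K` that `φ` maps into
`G`; it is the union of the pairwise disjoint full simplices `F ∈ 𝓕`. -/
structure IsCoveringMap {V W : Type*} [DecidableEq V] [DecidableEq W]
    (K : AbstractSimplicialComplex V) (M : AbstractSimplicialComplex W) (φ : V → W) : Prop where
  connected : K.IsConnected
  simplicial : IsSimplicialMap K M φ
  preimage : ∀ G, M.IsFace G → ∃ 𝓕 : Set (Finset V),
    𝓕.PairwiseDisjoint id ∧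
    (∀ F ∈ 𝓕, K.IsFace F ∧ Set.BijOn φ F G) ∧
    ∀ F ∈ K, F.image φ ⊆ G ↔ ∃ F' ∈ 𝓕, F ⊆ F'

/-- Strong coverings: every face over `G ∈ ∂G'` lies in the boundary of a face over `G'`. -/
structure IsStrongCovering {V W : Type*} [DecidableEq V] [DecidableEq W]
    (K : AbstractSimplicialComplex V) (M : AbstractSimplicialComplex W) (φ : V → W) : Prop
    extends IsCoveringMap K M φ where
  lift : ∀ G G', M.IsFace G → M.IsFace G' → InBoundary G G' →
    ∀ F ∈ facesOver K φ G, ∃ F' ∈ facesOver K φ G', InBoundary F F'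

/-- `k`-fold coverings: strong coverings with exactly `k ≥ 1` faces over each nonempty face of the
base. -/
structure IsKFoldCovering {V W : Type*} [DecidableEq V] [DecidableEq W]
    (K : AbstractSimplicialComplex V) (M : AbstractSimplicialComplex W) (φ : V → W) (k : ℕ) : Prop
    extends IsStrongCovering K M φ where
  pos : 0 < k
  degree : ∀ G ∈ M, (facesOver K φ G).ncard = k

end

end AbstractSimplicialComplex

/-! Say that a vertex map `φ` is a *local isomorphism* if, for every nonempty face `F`, it maps the
vertices of the link of `F` bijectively onto those of the link of `φ(F)`. A strong covering is a
local isomorphism, and a `k`-fold one is moreover surjective. The adjoint `δ*` is a weighted sum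
over the vertices of the link,
`(δ* f)([u₁, …, uₙ]) = w(u)⁻¹ ∑ₓ w({x} ∪ u) f([x, u₁, …, uₙ])`,
and the normalized weight of a nonempty face is likewise determined by its link. Hence, away from
the empty face, the pullback `φ*` of cochains commutes with `δ` and with `δ*`, so it is an injective
map intertwining the down Laplace operators of `M` and `K`.

In dimension `0` the link of the empty face is the whole vertex set, and `φ*` commutes with `δ`
only. There one has `δ* δ = 1` for the normalized weights, and `φ*` becomes an intertwining map
after correcting it by a coboundary. -/

namespace SimplicialCovering

open AbstractSimplicialComplex Set

noncomputable section

/-! ### Characteristic polynomials of intertwined operators -/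

section Spectrum

open Module.Basis in
theorem charpoly_restrict_dvd {R V : Type*} [CommRing R] [AddCommGroup V] [Module R V]
    [Module.Finite R V] [Module.Free R V] (W : Submodule R V) [Module.Free R W]
    [Module.Finite R W] [Module.Free R (V ⧸ W)] (T : V →ₗ[R] V) (hT : ∀ x ∈ W, T x ∈ W) :
    (T.restrict hT).charpoly ∣ T.charpoly := by
  classical
  let bW := Module.Free.chooseBasis R W
  let b := sumQuot bW (Module.Free.chooseBasis R (V ⧸ W))
  have blocks : LinearMap.toMatrix b b T =
      Matrix.fromBlocks (LinearMap.toMatrix bW bW (T.restrict hT))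
        (LinearMap.toMatrix b b T).toBlocks₁₂ 0 (LinearMap.toMatrix b b T).toBlocks₂₂ := by
    rw [← Matrix.fromBlocks_toBlocks (LinearMap.toMatrix b b T)]
    congr 1
    · ext i j
      simp only [Matrix.toBlocks₁₁, Matrix.of_apply, LinearMap.toMatrix_apply, b, sumQuot_inl]
      exact sumQuot_repr_inl_of_mem _ _ _ (hT _ (bW j).2) _
    · ext i j
      simp only [Matrix.toBlocks₂₁, Matrix.of_apply, LinearMap.toMatrix_apply, b, sumQuot_inl]
      exact sumQuot_repr_inr_of_mem _ _ _ (hT _ (bW j).2) _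
  rw [← LinearMap.charpoly_toMatrix T b, blocks, Matrix.charpoly_fromBlocks_zero₂₁,
    LinearMap.charpoly_toMatrix]
  exact dvd_mul_right _ _

theorem charpoly_dvd_of_injective_of_comp_eq {𝕜 E U : Type*} [Field 𝕜]
    [AddCommGroup E] [Module 𝕜 E] [FiniteDimensional 𝕜 E]
    [AddCommGroup U] [Module 𝕜 U] [FiniteDimensional 𝕜 U]
    {A : U →ₗ[𝕜] U} {B : E →ₗ[𝕜] E} {J : E →ₗ[𝕜] U} (hJ : Function.Injective J)
    (h : A ∘ₗ J = J ∘ₗ B) : B.charpoly ∣ A.charpoly := by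
  have mapsTo_range : ∀ y ∈ LinearMap.range J, A y ∈ LinearMap.range J := by
    rintro _ ⟨x, rfl⟩
    exact ⟨B x, (LinearMap.congr_fun h x).symm⟩
  have conj_eq_restrict : (LinearEquiv.ofInjective J hJ).conj B = A.restrict mapsTo_range := by
    ext ⟨_, x, rfl⟩
    have hx : (LinearEquiv.ofInjective J hJ).symm ⟨J x, x, rfl⟩ = x :=
      (LinearEquiv.symm_apply_eq _).mpr rfl
    rw [LinearEquiv.conj_apply_apply, hx]
    exact (LinearMap.congr_fun h x).symm
  rw [← (LinearEquiv.ofInjective J hJ).charpoly_conj B, conj_eq_restrict]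
  exact charpoly_restrict_dvd _ A mapsTo_range

variable {E U : Type*} [AddCommGroup E] [Module ℝ E] [FiniteDimensional ℝ E]
  [AddCommGroup U] [Module ℝ U] [FiniteDimensional ℝ U]

theorem multisetSpectrum_le_of_injective_of_comp_eq {A : U →ₗ[ℝ] U} {B : E →ₗ[ℝ] E}
    {J : E →ₗ[ℝ] U} (hJ : Function.Injective J) (h : A ∘ₗ J = J ∘ₗ B) :
    multisetSpectrum B ≤ multisetSpectrum A :=
  Polynomial.roots.le_of_dvd (A.charpoly_monic.map _).ne_zero
    (Polynomial.map_dvd _ (charpoly_dvd_of_injective_of_comp_eq hJ h))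

/-- The projections `d s` and `d' s'` have as images copies of `E₀` and `U₀`. The intertwining map
is `q + d' (p s - s' q)`: it maps the image of `d` to that of `d'` and `ker s` to `ker s'`. -/
theorem multisetSpectrum_le_of_leftInverse {E₀ U₀ : Type*} [AddCommGroup E₀] [Module ℝ E₀]
    [AddCommGroup U₀] [Module ℝ U₀] {d : E₀ →ₗ[ℝ] E} {s : E →ₗ[ℝ] E₀} {d' : U₀ →ₗ[ℝ] U}
    {s' : U →ₗ[ℝ] U₀} (hsd : Function.LeftInverse s d) (hsd' : Function.LeftInverse s' d')
    {p : E₀ →ₗ[ℝ] U₀} {q : E →ₗ[ℝ] U} (hp : Function.Surjective p) (hq : Function.Injective q)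
    (hqd : ∀ a, q (d a) = d' (p a)) :
    multisetSpectrum (d ∘ₗ s) ≤ multisetSpectrum (d' ∘ₗ s') := by
  let J : E →ₗ[ℝ] U := q + d' ∘ₗ (p ∘ₗ s - s' ∘ₗ q)
  have J_apply (x : E) : J x = q x + d' (p (s x) - s' (q x)) := rfl
  have J_d (a : E₀) : J (d a) = q (d a) := by
    rw [J_apply, hsd, hqd, hsd', sub_self, map_zero, add_zero]
  refine multisetSpectrum_le_of_injective_of_comp_eq (J := J) ?_ ?_
  · refine (injective_iff_map_eq_zero J).mpr fun x hx => ?_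
    obtain ⟨a, ha⟩ := hp (s' (q x) - p (s x))
    have hxa : x = d a := hq <| by
      rw [hqd, ha, ← neg_sub, map_neg]
      exact eq_neg_of_add_eq_zero_left hx
    rw [hxa, J_d] at hx
    rw [hxa, hq (hx.trans (map_zero q).symm)]
  · ext x
    have retraction_J : s' (J x) = p (s x) := by
      rw [J_apply, map_add, hsd', add_sub_cancel]
    change d' (s' (J x)) = J (d (s x))
    rw [retraction_J, J_d, hqd]

end Spectrum

/-! ### Ordered faces -/

section OrderedFace

variable {V : Type*} {K : AbstractSimplicialComplex V} {n : ℕ}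

instance [Finite V] : Fintype (K.OrderedFace n) :=
  Fintype.ofFinite _

/-- The underlying vertex set of an ordered face. -/
def vertices (v : K.OrderedFace n) : Finset V :=
  Finset.univ.map v.1

theorem isFace_vertices (v : K.OrderedFace n) : K.IsFace (vertices v) := v.2

theorem card_vertices (v : K.OrderedFace n) : (vertices v).card = n := by
  simp [vertices]

theorem mem_vertices {v : K.OrderedFace n} {x : V} : x ∈ vertices v ↔ x ∈ range v.1 := by
  simp [vertices]

theorem apply_mem_vertices (v : K.OrderedFace n) (a : Fin n) : v.1 a ∈ vertices v :=
  mem_vertices.mpr ⟨a, rfl⟩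

theorem vertices_nonempty (v : K.OrderedFace (n + 1)) : (vertices v).Nonempty :=
  ⟨v.1 0, apply_mem_vertices v 0⟩

theorem orderedFace_ext {u v : K.OrderedFace n} (h : ∀ a, u.1 a = v.1 a) : u = v :=
  Subtype.ext (DFunLike.ext _ _ h)

instance : Subsingleton (K.OrderedFace 0) :=
  ⟨fun _ _ => orderedFace_ext fun a => a.elim0⟩

theorem vertices_eq_empty (v : K.OrderedFace 0) : vertices v = ∅ :=
  Finset.card_eq_zero.mp (card_vertices v)

theorem vertices_perm (v : K.OrderedFace n) (σ : Equiv.Perm (Fin n)) :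
    vertices (v.perm σ) = vertices v := by
  ext x
  rw [mem_vertices, mem_vertices]
  exact iff_of_eq (congrArg (x ∈ ·) (σ.surjective.range_comp v.1))

theorem vertices_ordering (F : K.Face n) : vertices F.ordering = F.1 := by
  refine Finset.eq_of_subset_of_card_le (fun x hx => ?_) ?_
  · obtain ⟨a, rfl⟩ := mem_vertices.mp hx
    exact ((F.1.equivFinOfCardEq F.2.2).symm a).2
  · rw [card_vertices, F.2.2]

theorem perm_bijective (σ : Equiv.Perm (Fin n)) :
    Function.Bijective fun v : K.OrderedFace n => v.perm σ :=
  Function.bijective_iff_has_inverse.mpr ⟨fun v => v.perm σ⁻¹,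
    fun v => orderedFace_ext fun a => congrArg v.1 (σ.apply_symm_apply a),
    fun v => orderedFace_ext fun a => congrArg v.1 (σ.symm_apply_apply a)⟩

theorem ordering_perm_bijective :
    Function.Bijective fun p : K.Face n × Equiv.Perm (Fin n) => p.1.ordering.perm p.2 := by
  refine ⟨fun ⟨F, σ⟩ ⟨F', σ'⟩ h => ?_, fun v => ?_⟩
  · obtain rfl : F = F' := Subtype.ext <| by
      simpa only [vertices_perm, vertices_ordering] using congrArg vertices h
    obtain rfl : σ = σ' := Equiv.ext fun a =>
      F.ordering.1.injective (DFunLike.congr_fun (congrArg Subtype.val h) a)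
    rfl
  · obtain ⟨F, σ, h⟩ := exists_ordering_perm v
    exact ⟨(F, σ), h.symm⟩

theorem sign_mul_sign (σ : Equiv.Perm (Fin n)) :
    ((Equiv.Perm.sign σ : ℤ) : ℝ) * ((Equiv.Perm.sign σ : ℤ) : ℝ) = 1 := by
  rw [← Int.cast_mul, ← Units.val_mul, Int.units_mul_self, Units.val_one, Int.cast_one]

variable [Finite V] {w : K.FaceWeight}

theorem factorial_mul_inner (f g : WCochain w n) :
    (n.factorial : ℝ) * inner ℝ f g =
      ∑ v : K.OrderedFace n, w.toFun (vertices v) * f.1 v * g.1 v := by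
  have inner_eq : inner ℝ f g = ∑ F : K.Face n, w.toFun F.1 * f.1 F.ordering * g.1 F.ordering :=
    rfl
  have term_perm (F : K.Face n) (σ : Equiv.Perm (Fin n)) :
      w.toFun (vertices (F.ordering.perm σ)) * f.1 (F.ordering.perm σ) * g.1 (F.ordering.perm σ) =
        w.toFun F.1 * f.1 F.ordering * g.1 F.ordering := by
    rw [vertices_perm, vertices_ordering, f.2 F.ordering σ, g.2 F.ordering σ]
    linear_combination (w.toFun F.1 * f.1 F.ordering * g.1 F.ordering) * sign_mul_sign σ
  rw [inner_eq, ← ordering_perm_bijective.sum_comp, Fintype.sum_prod_type, Finset.mul_sum]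
  simp [term_perm, Fintype.card_perm]

/-- Moving the `j`-th vertex to the front turns every summand of the coboundary into the one for
`j = 0`. -/
theorem sum_mul_coboundary (f : WCochain w (n + 1)) (g : WCochain w n) :
    ∑ v, w.toFun (vertices v) * f.1 v * (wCoboundary w n g).1 v =
      (n + 1) * ∑ v, w.toFun (vertices v) * f.1 v * g.1 (v.dropVertex 0) := by
  have summand (j : Fin (n + 1)) :
      ∑ v, w.toFun (vertices v) * f.1 v * ((-1) ^ (j : ℕ) * g.1 (v.dropVertex j)) =
        ∑ v, w.toFun (vertices v) * f.1 v * g.1 (v.dropVertex 0) := by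
    rw [← (perm_bijective j.cycleRange).sum_comp]
    refine Finset.sum_congr rfl fun v _ => ?_
    have dropVertex_cycleRange : (v.perm j.cycleRange).dropVertex j = v.dropVertex 0 :=
      orderedFace_ext fun a => congrArg v.1 <| by
        change j.cycleRange (j.succAbove a) = Fin.succAbove 0 a
        rw [Fin.cycleRange_succAbove, Fin.zero_succAbove]
    have sign_sq := sign_mul_sign j.cycleRange
    rw [dropVertex_cycleRange, vertices_perm, f.2 v]
    rw [Fin.sign_cycleRange] at sign_sq ⊢
    push_cast at sign_sq ⊢
    linear_combination (w.toFun (vertices v) * f.1 v * g.1 (v.dropVertex 0)) * sign_sq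
  have coboundary_apply (v : K.OrderedFace (n + 1)) :
      (wCoboundary w n g).1 v = ∑ j : Fin (n + 1), (-1) ^ (j : ℕ) * g.1 (v.dropVertex j) := rfl
  simp only [coboundary_apply, Finset.mul_sum]
  rw [Finset.sum_comm, ← Finset.mul_sum]
  simp [summand]

end OrderedFace

/-! ### Links and the adjoint of the coboundary -/

section Link

variable {V : Type*} [DecidableEq V] {K : AbstractSimplicialComplex V} {n : ℕ}

/-- The vertex set of the link of `F` in `K`. -/
def linkVertices (K : AbstractSimplicialComplex V) (F : Finset V) : Set V :=
  {x | x ∉ F ∧ K.IsFace (insert x F)}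

instance [Finite V] (F : Finset V) : Fintype (linkVertices K F) :=
  Fintype.ofFinite _

theorem linkVertices_empty : linkVertices K ∅ = univ :=
  eq_univ_of_forall fun x => ⟨Finset.notMem_empty x, Or.inr (K.singleton_mem x)⟩

/-- The ordered face `[x, u₁, …, uₙ]`. -/
def cons (u : K.OrderedFace n) (x : linkVertices K (vertices u)) : K.OrderedFace (n + 1) :=
  ⟨Fin.Embedding.cons u.1 (mt mem_vertices.mpr x.2.1), x.2.2.mono fun y hy => by
    obtain ⟨a, -, rfl⟩ := Finset.mem_map.mp hy
    refine Fin.cases ?_ (fun b => ?_) a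
    · exact Finset.mem_insert_self _ _
    · exact Finset.mem_insert_of_mem (apply_mem_vertices u b)⟩

theorem vertices_cons (u : K.OrderedFace n) (x : linkVertices K (vertices u)) :
    vertices (cons u x) = insert x.1 (vertices u) := by
  ext y
  rw [mem_vertices, Finset.mem_insert, mem_vertices]
  change y ∈ range (Fin.cons x.1 u.1 : Fin (n + 1) → V) ↔ _
  rw [Fin.range_cons, mem_insert_iff]

theorem cons_perm (u : K.OrderedFace n) (σ : Equiv.Perm (Fin n))
    (x : linkVertices K (vertices (u.perm σ))) :
    cons (u.perm σ) x =
      (cons u ⟨x.1, vertices_perm u σ ▸ x.2⟩).perm (Equiv.Perm.decomposeFin.symm (0, σ)) := by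
  refine orderedFace_ext (Fin.cases ?_ fun a => ?_)
  · exact congrArg (Fin.cons x.1 u.1 : Fin (n + 1) → V)
      (Equiv.Perm.decomposeFin_symm_apply_zero 0 σ).symm
  · refine congrArg (Fin.cons x.1 u.1 : Fin (n + 1) → V)
      (?_ : (σ a).succ = Equiv.Perm.decomposeFin.symm (0, σ) a.succ)
    rw [Equiv.Perm.decomposeFin_symm_apply_succ, Equiv.swap_self, Equiv.refl_apply]

theorem dropVertex_zero_cons (u : K.OrderedFace n) (x : linkVertices K (vertices u)) :
    (cons u x).dropVertex 0 = u :=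
  orderedFace_ext fun a => by
    change (Fin.cons x.1 u.1 : Fin (n + 1) → V) (Fin.succAbove 0 a) = u.1 a
    rw [Fin.zero_succAbove, Fin.cons_succ]

theorem cons_dropVertex_zero (v : K.OrderedFace (n + 1)) :
    ∃ x : linkVertices K (vertices (v.dropVertex 0)), cons (v.dropVertex 0) x = v := by
  have zero_notMem : v.1 0 ∉ vertices (v.dropVertex 0) := fun h => by
    obtain ⟨a, ha⟩ := mem_vertices.mp h
    exact Fin.succAbove_ne 0 a (v.1.injective ha)
  have insert_subset : insert (v.1 0) (vertices (v.dropVertex 0)) ⊆ vertices v := by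
    refine Finset.insert_subset (apply_mem_vertices v 0) fun x hx => ?_
    obtain ⟨a, rfl⟩ := mem_vertices.mp hx
    exact apply_mem_vertices v _
  refine ⟨⟨v.1 0, zero_notMem, (isFace_vertices v).mono insert_subset⟩, orderedFace_ext ?_⟩
  exact Fin.cases rfl fun a => congrArg v.1 (Fin.zero_succAbove a)

theorem cons_bijective : Function.Bijective
    fun p : (u : K.OrderedFace n) × linkVertices K (vertices u) => cons p.1 p.2 := by
  refine ⟨?_, fun v => ?_⟩
  · rintro ⟨u, x⟩ ⟨u', x'⟩ h
    obtain rfl : u = u' := by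
      simpa only [dropVertex_zero_cons] using congrArg (OrderedFace.dropVertex · 0) h
    obtain rfl : x = x' := Subtype.ext (DFunLike.congr_fun (congrArg Subtype.val h) 0)
    rfl
  · obtain ⟨x, hx⟩ := cons_dropVertex_zero v
    exact ⟨⟨_, x⟩, hx⟩

theorem sum_orderedFace_succ [Finite V] (h : K.OrderedFace (n + 1) → ℝ) :
    ∑ v, h v = ∑ u : K.OrderedFace n, ∑ x : linkVertices K (vertices u), h (cons u x) := by
  rw [← cons_bijective.sum_comp, Fintype.sum_sigma]

variable [Finite V] {w : K.FaceWeight}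

/-- The weighted sum over the link that computes the adjoint of the coboundary, see
`adjoint_wCoboundary`. -/
def linkSum (f : WCochain w (n + 1)) : WCochain w n :=
  ⟨fun u => (w.toFun (vertices u))⁻¹ *
    ∑ x : linkVertices K (vertices u), w.toFun (insert x.1 (vertices u)) * f.1 (cons u x), by
    intro u σ
    have hu := vertices_perm u σ
    have weight_insert (x : V) :
        w.toFun (insert x (vertices (u.perm σ))) = w.toFun (insert x (vertices u)) := by rw [hu]
    simp only [Finset.mul_sum]
    refine Fintype.sum_equiv (Equiv.setCongr (congrArg (linkVertices K) hu)) _ _ fun x => ?_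
    rw [weight_insert, congrArg w.toFun hu, cons_perm, f.2, Equiv.Perm.decomposeFin.symm_sign,
      if_pos rfl, one_mul, Equiv.setCongr_apply]
    ring⟩

theorem inner_linkSum (f : WCochain w (n + 1)) (g : WCochain w n) :
    inner ℝ (linkSum f) g = inner ℝ f (wCoboundary w n g) := by
  have sum_link (u : K.OrderedFace n) :
      ∑ x, w.toFun (vertices (cons u x)) * f.1 (cons u x) * g.1 ((cons u x).dropVertex 0) =
        w.toFun (vertices u) * (linkSum f).1 u * g.1 u := by
    simp only [dropVertex_zero_cons, vertices_cons, linkSum]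
    rw [mul_inv_cancel_left₀ (w.pos _ (isFace_vertices u)).ne', Finset.sum_mul]
  refine mul_left_cancel₀ (Nat.cast_ne_zero (R := ℝ).mpr (n + 1).factorial_ne_zero) ?_
  calc ((n + 1).factorial : ℝ) * inner ℝ (linkSum f) g
      = (n + 1) * ∑ u, w.toFun (vertices u) * (linkSum f).1 u * g.1 u := by
        rw [← factorial_mul_inner, Nat.factorial_succ, Nat.cast_mul, Nat.cast_succ, mul_assoc]
    _ = (n + 1) * ∑ v, w.toFun (vertices v) * f.1 v * g.1 (v.dropVertex 0) := by
        rw [sum_orderedFace_succ]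
        simp only [sum_link]
    _ = (n + 1).factorial * inner ℝ f (wCoboundary w n g) := by
        rw [factorial_mul_inner, sum_mul_coboundary]

theorem adjoint_wCoboundary (f : WCochain w (n + 1)) :
    LinearMap.adjoint (wCoboundary w n) f = linkSum f :=
  ext_inner_right ℝ fun g => by rw [LinearMap.adjoint_inner_left, inner_linkSum]

end Link

/-! ### The normalized weight -/

section NormalizedWeight

variable {V : Type*} [DecidableEq V] {K : AbstractSimplicialComplex V}

theorem maximal_isFace_iff {F : Finset V} (hF : K.IsFace F) :
    Maximal K.IsFace F ↔ linkVertices K F = ∅ := by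
  refine ⟨fun hmax => eq_empty_of_forall_notMem fun x hx => hx.1 ?_, fun hlink => ?_⟩
  · exact hmax.le_of_ge hx.2 (Finset.subset_insert x F) (Finset.mem_insert_self x F)
  · refine ⟨hF, fun G hG hFG x hxG => by_contra fun hxF => ?_⟩
    have hx : x ∈ linkVertices K F := ⟨hxF, hG.mono (Finset.insert_subset hxG hFG)⟩
    exact (hlink ▸ hx : x ∈ (∅ : Set V))

theorem exists_insert_eq_of_inBoundary {F G : Finset V} (hG : K.IsFace G) (h : InBoundary F G) :
    ∃ x : linkVertices K F, insert x.1 F = G := by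
  obtain ⟨x, hxF, rfl⟩ := Finset.exists_eq_insert_iff.mpr ⟨h.1, h.2.symm⟩
  exact ⟨⟨x, hxF, hG⟩, rfl⟩

variable [Fintype V]

theorem normalizedWeightFun_of_linkVertices_eq_empty {F : Finset V} (hF : K.IsFace F)
    (hlink : linkVertices K F = ∅) : normalizedWeightFun K F = 1 := by
  rw [normalizedWeightFun, if_pos ((maximal_isFace_iff hF).mpr hlink)]

theorem normalizedWeightFun_of_linkVertices_nonempty {F : Finset V} (hF : K.IsFace F)
    (hlink : (linkVertices K F).Nonempty) :
    normalizedWeightFun K F = ∑ x : linkVertices K F, normalizedWeightFun K (insert x.1 F) := by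
  classical
  rw [normalizedWeightFun, if_neg (mt (maximal_isFace_iff hF).mp hlink.ne_empty),
    Finset.sum_attach _ (normalizedWeightFun K)]
  symm
  refine Finset.sum_bij (fun x _ => insert x.1 F) (fun x _ => ?_) (fun x _ x' _ h => ?_)
    (fun G hG => ?_) fun _ _ => rfl
  · exact Finset.mem_filter.mpr ⟨Finset.mem_univ _, x.2.2, Finset.subset_insert _ _,
      Finset.card_insert_of_notMem x.2.1⟩
  · have hx : x.1 ∈ insert x'.1 F := h ▸ Finset.mem_insert_self x.1 F
    exact Subtype.ext ((Finset.mem_insert.mp hx).resolve_right x.2.1)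
  · obtain ⟨-, hG, hFG⟩ := Finset.mem_filter.mp hG
    obtain ⟨x, hx⟩ := exists_insert_eq_of_inBoundary hG hFG
    exact ⟨x, Finset.mem_univ x, hx⟩

theorem adjoint_wCoboundary_zero_leftInverse {V : Type*} [Fintype V] [Nonempty V]
    {K : AbstractSimplicialComplex V} :
    Function.LeftInverse (LinearMap.adjoint (wCoboundary (normalizedWeight K) 0))
      (wCoboundary (normalizedWeight K) 0) := by
  classical
  intro c
  rw [adjoint_wCoboundary]
  refine Subtype.ext (funext fun u => ?_)
  have coboundary_cons (x : linkVertices K (vertices u)) :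
      (wCoboundary (normalizedWeight K) 0 c).1 (cons u x) = c.1 u := by
    change ∑ j : Fin 1, (-1 : ℝ) ^ (j : ℕ) * c.1 ((cons u x).dropVertex j) = c.1 u
    rw [Fin.sum_univ_one, dropVertex_zero_cons, Fin.val_zero, pow_zero, one_mul]
  have hlink : (linkVertices K (vertices u)).Nonempty := by
    rw [vertices_eq_empty, linkVertices_empty]
    exact univ_nonempty
  have weight_eq : (normalizedWeight K).toFun (vertices u) =
      ∑ x : linkVertices K (vertices u), (normalizedWeight K).toFun (insert x.1 (vertices u)) :=
    normalizedWeightFun_of_linkVertices_nonempty (isFace_vertices u) hlink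
  simp only [linkSum, coboundary_cons]
  rw [← Finset.sum_mul, ← weight_eq,
    inv_mul_cancel_left₀ ((normalizedWeight K).pos _ (isFace_vertices u)).ne']

end NormalizedWeight

/-! ### Local isomorphisms -/

section LocalIso

variable {V W : Type*} [DecidableEq V] [DecidableEq W]
  {K : AbstractSimplicialComplex V} {M : AbstractSimplicialComplex W} {φ : V → W} {n k : ℕ}

/-- Local isomorphisms of simplicial complexes: vertex maps that are bijective between the links of
a nonempty face and of its image. That such a map is simplicial and injective on faces follows. -/
def IsLocalIso (K : AbstractSimplicialComplex V) (M : AbstractSimplicialComplex W)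
    (φ : V → W) : Prop :=
  ∀ F, K.IsFace F → F.Nonempty → BijOn φ (linkVertices K F) (linkVertices M (F.image φ))

theorem injOn_of_isCoveringMap (hφ : AbstractSimplicialComplex.IsCoveringMap K M φ)
    {F : Finset V} (hF : K.IsFace F) : InjOn φ F := by
  obtain ⟨𝓕, -, bijOn, subset_iff⟩ := hφ.preimage _ (hφ.simplicial F hF)
  rcases hF with rfl | hF
  · simp
  · obtain ⟨F', hF', hle⟩ := (subset_iff F hF).mp subset_rfl
    exact (bijOn F' hF').2.injOn.mono (Finset.coe_subset.mpr hle)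

theorem eq_of_isCoveringMap_of_image_eq (hφ : AbstractSimplicialComplex.IsCoveringMap K M φ)
    {F₁ F₂ : Finset V} (h₁ : K.IsFace F₁) (h₂ : K.IsFace F₂) (h : F₁.image φ = F₂.image φ)
    (hmeet : (F₁ ∩ F₂).Nonempty) : F₁ = F₂ := by
  obtain ⟨x, hx⟩ := hmeet
  obtain ⟨hx₁, hx₂⟩ := Finset.mem_inter.mp hx
  obtain ⟨𝓕, disjoint, bijOn, subset_iff⟩ := hφ.preimage _ (hφ.simplicial F₁ h₁)
  have mem_sheets (F : Finset V) (hF : K.IsFace F) (hxF : x ∈ F)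
      (himage : F.image φ = F₁.image φ) : F ∈ 𝓕 := by
    obtain ⟨F', hF', hle⟩ :=
      (subset_iff F (hF.resolve_left (Finset.ne_empty_of_mem hxF))).mp himage.subset
    suffices F' ⊆ F from hle.antisymm this ▸ hF'
    intro y hy
    have hφy : φ y ∈ F.image φ := himage ▸ Finset.mem_coe.mp ((bijOn F' hF').2.mapsTo hy)
    obtain ⟨z, hz, hzy⟩ := Finset.mem_image.mp hφy
    rwa [← (bijOn F' hF').2.injOn (hle hz) hy hzy]
  by_contra hne
  exact Finset.disjoint_left.mp
    (disjoint (mem_sheets F₁ h₁ hx₁ rfl) (mem_sheets F₂ h₂ hx₂ h.symm) hne) hx₁ hx₂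

theorem isLocalIso_of_isStrongCovering (hφ : IsStrongCovering K M φ) : IsLocalIso K M φ := by
  have injOn {F : Finset V} (hF : K.IsFace F) : InjOn φ F :=
    injOn_of_isCoveringMap hφ.toIsCoveringMap hF
  rintro F hF ⟨z, hz⟩
  refine ⟨fun x hx => ⟨fun hmem => hx.1 ?_, ?_⟩, fun x hx x' hx' hxx' => ?_, fun y hy => ?_⟩
  · obtain ⟨x', hx', hxx'⟩ := Finset.mem_image.mp hmem
    rwa [← injOn hx.2 (Finset.mem_insert_of_mem hx') (Finset.mem_insert_self x F) hxx']
  · exact Finset.image_insert φ x F ▸ hφ.simplicial _ hx.2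
  · have hface : insert x F = insert x' F :=
      eq_of_isCoveringMap_of_image_eq hφ.toIsCoveringMap hx.2 hx'.2
        (by rw [Finset.image_insert, Finset.image_insert, hxx'])
        ⟨z, Finset.mem_inter.mpr ⟨Finset.mem_insert_of_mem hz, Finset.mem_insert_of_mem hz⟩⟩
    have hmem : x ∈ insert x' F := hface ▸ Finset.mem_insert_self x F
    exact (Finset.mem_insert.mp hmem).resolve_right hx.1
  · obtain ⟨F', ⟨hF', himage⟩, hsub, -⟩ := hφ.lift _ _ (hφ.simplicial F hF) hy.2
      ⟨Finset.subset_insert _ _, Finset.card_insert_of_notMem hy.1⟩ F ⟨hF, rfl⟩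
    obtain ⟨x, hx, rfl⟩ := Finset.mem_image.mp (himage ▸ Finset.mem_insert_self y _)
    exact ⟨x, ⟨fun hxF => hy.1 (Finset.mem_image_of_mem φ hxF),
      hF'.mono (Finset.insert_subset hx hsub)⟩, rfl⟩

theorem surjective_of_isKFoldCovering (hφ : IsKFoldCovering K M φ k) :
    Function.Surjective φ := fun y => by
  have ncard_ne_zero : (facesOver K φ {y}).ncard ≠ 0 :=
    hφ.degree {y} (M.singleton_mem y) ▸ hφ.pos.ne'
  obtain ⟨F, -, hF⟩ := nonempty_of_ncard_ne_zero ncard_ne_zero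
  obtain ⟨x, -, hx⟩ := Finset.mem_image.mp (hF ▸ Finset.mem_singleton_self y)
  exact ⟨x, hx⟩

namespace IsLocalIso

theorem isFace_image (hφ : IsLocalIso K M φ) {F : Finset V} (hF : K.IsFace F) :
    M.IsFace (F.image φ) := by
  induction F using Finset.induction_on with
  | empty => exact Or.inl rfl
  | insert x F hx ih =>
    rw [Finset.image_insert]
    rcases F.eq_empty_or_nonempty with rfl | hne
    · exact Or.inr (M.singleton_mem (φ x))
    · exact ((hφ F (hF.mono (Finset.subset_insert x F)) hne).mapsTo ⟨hx, hF⟩).2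

theorem mapsTo_linkVertices (hφ : IsLocalIso K M φ) {F : Finset V} (hF : K.IsFace F) :
    MapsTo φ (linkVertices K F) (linkVertices M (F.image φ)) := by
  rcases F.eq_empty_or_nonempty with rfl | hne
  · rw [Finset.image_empty, linkVertices_empty, linkVertices_empty]
    exact mapsTo_univ _ _
  · exact (hφ F hF hne).mapsTo

theorem injOn (hφ : IsLocalIso K M φ) {F : Finset V} (hF : K.IsFace F) : InjOn φ F := by
  intro x hx y hy hxy
  by_contra hne
  have hlink : x ∈ linkVertices K (F.erase x) :=
    ⟨Finset.notMem_erase x F, by rwa [Finset.insert_erase hx]⟩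
  refine (hφ.mapsTo_linkVertices (hF.mono (Finset.erase_subset x F)) hlink).1 ?_
  exact hxy ▸ Finset.mem_image_of_mem φ (Finset.mem_erase.mpr ⟨Ne.symm hne, hy⟩)

theorem normalizedWeightFun_image [Fintype V] [Fintype W] (hφ : IsLocalIso K M φ)
    {F : Finset V} (hF : K.IsFace F) (hne : F.Nonempty) :
    normalizedWeightFun K F = normalizedWeightFun M (F.image φ) := by
  have bijOn := hφ F hF hne
  rcases (linkVertices K F).eq_empty_or_nonempty with hlink | hlink
  · rw [normalizedWeightFun_of_linkVertices_eq_empty hF hlink,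
      normalizedWeightFun_of_linkVertices_eq_empty (hφ.isFace_image hF)
        (by rw [← bijOn.image_eq, hlink, image_empty])]
  · rw [normalizedWeightFun_of_linkVertices_nonempty hF hlink,
      normalizedWeightFun_of_linkVertices_nonempty (hφ.isFace_image hF)
        (bijOn.image_eq ▸ hlink.image φ)]
    refine Fintype.sum_equiv (bijOn.equiv φ) _ _ fun x => ?_
    rw [hφ.normalizedWeightFun_image x.2.2 (Finset.insert_nonempty _ _), Finset.image_insert]
    rfl
termination_by Fintype.card V - F.card
decreasing_by
  have card_insert := Finset.card_insert_of_notMem x.2.1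
  have card_le := Finset.card_le_univ (insert x.1 F)
  omega

/-! ### Pullback of cochains -/

/-- The image of an ordered face under a local isomorphism. -/
def map (hφ : IsLocalIso K M φ) (u : K.OrderedFace n) : M.OrderedFace n :=
  ⟨⟨φ ∘ u.1, fun a b h => u.1.injective <|
      hφ.injOn u.2 (apply_mem_vertices u a) (apply_mem_vertices u b) h⟩,
    (hφ.isFace_image u.2).mono fun y hy => by
      obtain ⟨a, -, rfl⟩ := Finset.mem_map.mp hy
      exact Finset.mem_image_of_mem φ (apply_mem_vertices u a)⟩

theorem vertices_map (hφ : IsLocalIso K M φ) (u : K.OrderedFace n) :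
    vertices (hφ.map u) = (vertices u).image φ := by
  ext y
  simp only [mem_vertices, Finset.mem_image, exists_range_iff]
  rfl

theorem bijOn_linkVertices_map (hφ : IsLocalIso K M φ) (u : K.OrderedFace (n + 1)) :
    BijOn φ (linkVertices K (vertices u)) (linkVertices M (vertices (hφ.map u))) :=
  hφ.vertices_map u ▸ hφ _ (isFace_vertices u) (vertices_nonempty u)

theorem map_cons (hφ : IsLocalIso K M φ) (u : K.OrderedFace n)
    (x : linkVertices K (vertices u)) (y : linkVertices M (vertices (hφ.map u)))
    (hxy : φ x = y) : hφ.map (cons u x) = cons (hφ.map u) y :=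
  orderedFace_ext (Fin.cases hxy fun _ => rfl)

theorem map_surjective (hφ : IsLocalIso K M φ) (hsurj : Function.Surjective φ) :
    ∀ n, Function.Surjective (hφ.map : K.OrderedFace n → M.OrderedFace n)
  | 0 => fun _ => ⟨⟨Function.Embedding.ofIsEmpty, Or.inl rfl⟩, Subsingleton.elim _ _⟩
  | n + 1 => fun v => by
    obtain ⟨⟨v, y⟩, rfl⟩ := cons_bijective.surjective v
    obtain ⟨u, rfl⟩ := hφ.map_surjective hsurj n v
    obtain ⟨x, hx, hxy⟩ : ∃ x ∈ linkVertices K (vertices u), φ x = y.1 := by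
      cases n with
      | zero =>
        obtain ⟨x, hx⟩ := hsurj y.1
        exact ⟨x, by rw [vertices_eq_empty, linkVertices_empty]; trivial, hx⟩
      | succ n => exact (hφ.bijOn_linkVertices_map u).surjOn y.2
    exact ⟨cons u ⟨x, hx⟩, hφ.map_cons u ⟨x, hx⟩ y hxy⟩

/-- The pullback of cochains along a local isomorphism. -/
def pullback (hφ : IsLocalIso K M φ) (wM : M.FaceWeight) (wK : K.FaceWeight) (n : ℕ) :
    WCochain wM n →ₗ[ℝ] WCochain wK n where
  toFun f := ⟨fun u => f.1 (hφ.map u), fun u σ => f.2 (hφ.map u) σ⟩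
  map_add' _ _ := rfl
  map_smul' _ _ := rfl

variable {wM : M.FaceWeight} {wK : K.FaceWeight}

theorem pullback_injective (hφ : IsLocalIso K M φ) (hsurj : Function.Surjective φ) :
    Function.Injective (hφ.pullback wM wK n) := fun f g h => by
  refine Subtype.ext (funext fun v => ?_)
  obtain ⟨u, rfl⟩ := hφ.map_surjective hsurj n v
  exact congrFun (congrArg Subtype.val h) u

theorem pullback_zero_surjective (hφ : IsLocalIso K M φ) :
    Function.Surjective (hφ.pullback wM wK 0) := fun c =>
  let e : K.OrderedFace 0 := ⟨Function.Embedding.ofIsEmpty, Or.inl rfl⟩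
  ⟨⟨fun _ => c.1 e, fun v σ => by simp [Subsingleton.elim σ 1]⟩,
    Subtype.ext (funext fun u => congrArg c.1 (Subsingleton.elim e u))⟩

variable [Finite V] [Finite W]

theorem pullback_wCoboundary (hφ : IsLocalIso K M φ) (f : WCochain wM n) :
    hφ.pullback wM wK (n + 1) (wCoboundary wM n f) =
      wCoboundary wK n (hφ.pullback wM wK n f) :=
  rfl

theorem pullback_linkSum (hφ : IsLocalIso K M φ)
    (hw : ∀ F, K.IsFace F → F.Nonempty → wK.toFun F = wM.toFun (F.image φ))
    (f : WCochain wM (n + 2)) :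
    hφ.pullback wM wK (n + 1) (linkSum f) = linkSum (hφ.pullback wM wK (n + 2) f) := by
  refine Subtype.ext (funext fun u => ?_)
  have weight_map {m : ℕ} (v : K.OrderedFace (m + 1)) :
      wM.toFun (vertices (hφ.map v)) = wK.toFun (vertices v) := by
    rw [hw _ (isFace_vertices v) (vertices_nonempty v), vertices_map]
  change (wM.toFun (vertices (hφ.map u)))⁻¹ *
      ∑ y : linkVertices M (vertices (hφ.map u)),
        wM.toFun (insert y.1 (vertices (hφ.map u))) * f.1 (cons (hφ.map u) y) =
    (wK.toFun (vertices u))⁻¹ *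
      ∑ x : linkVertices K (vertices u),
        wK.toFun (insert x.1 (vertices u)) * f.1 (hφ.map (cons u x))
  rw [weight_map]
  refine congrArg _ (Fintype.sum_equiv ((hφ.bijOn_linkVertices_map u).equiv φ) _ _ fun x => ?_).symm
  rw [← vertices_cons, ← vertices_cons, ← hφ.map_cons u x _ rfl, weight_map]

theorem multisetSpectrum_downLaplacian_succ_le (hφ : IsLocalIso K M φ)
    (hsurj : Function.Surjective φ)
    (hw : ∀ F, K.IsFace F → F.Nonempty → wK.toFun F = wM.toFun (F.image φ)) (i : ℕ) :
    multisetSpectrum (downLaplacian wM (i + 1)) ≤ multisetSpectrum (downLaplacian wK (i + 1)) := by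
  refine multisetSpectrum_le_of_injective_of_comp_eq
    (hφ.pullback_injective (wM := wM) (wK := wK) hsurj) (LinearMap.ext fun f => ?_)
  simp only [downLaplacian, LinearMap.comp_apply, adjoint_wCoboundary, hφ.pullback_wCoboundary,
    hφ.pullback_linkSum hw]

theorem multisetSpectrum_normDownLaplacian_zero_le {V W : Type*} [Fintype V] [DecidableEq V]
    [Fintype W] [DecidableEq W] {K : AbstractSimplicialComplex V}
    {M : AbstractSimplicialComplex W} {φ : V → W} (hφ : IsLocalIso K M φ)
    (hsurj : Function.Surjective φ) :
    multisetSpectrum (M.normDownLaplacian 0) ≤ multisetSpectrum (K.normDownLaplacian 0) := by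
  let pullback (n : ℕ) := hφ.pullback (normalizedWeight M) (normalizedWeight K) n
  rcases isEmpty_or_nonempty V with hV | hV
  · refine multisetSpectrum_le_of_injective_of_comp_eq (J := pullback 1)
      (hφ.pullback_injective hsurj) (LinearMap.ext fun f => ?_)
    exact Subtype.ext (funext fun u => isEmptyElim (u.1 0))
  · have : Nonempty W := hV.map φ
    exact multisetSpectrum_le_of_leftInverse (p := pullback 0) (q := pullback 1)
      adjoint_wCoboundary_zero_leftInverse adjoint_wCoboundary_zero_leftInverse
      hφ.pullback_zero_surjective (hφ.pullback_injective hsurj) hφ.pullback_wCoboundary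

end IsLocalIso

end LocalIso

end

end SimplicialCovering

open SimplicialCovering in
theorem mainTheorem6_general {V W : Type*} [Fintype V] [DecidableEq V] [Fintype W] [DecidableEq W]
    (K : AbstractSimplicialComplex V) (M : AbstractSimplicialComplex W) (φ : V → W)
    (hφ : IsLocalIso K M φ) (hsurj : Function.Surjective φ) :
    (∀ i : ℕ, 1 ≤ i →
      AbstractSimplicialComplex.multisetSpectrum (M.combDownLaplacian i) ≤
        AbstractSimplicialComplex.multisetSpectrum (K.combDownLaplacian i)) ∧
    (∀ i : ℕ,
      AbstractSimplicialComplex.multisetSpectrum (M.normDownLaplacian i) ≤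
        AbstractSimplicialComplex.multisetSpectrum (K.normDownLaplacian i)) := by
  refine ⟨fun i hi => ?_, fun i => ?_⟩
  · obtain ⟨i, rfl⟩ := Nat.exists_eq_add_of_le' hi
    exact hφ.multisetSpectrum_downLaplacian_succ_le hsurj (fun _ _ _ => rfl) i
  · cases i with
    | zero => exact hφ.multisetSpectrum_normDownLaplacian_zero_le hsurj
    | succ i =>
      exact hφ.multisetSpectrum_downLaplacian_succ_le hsurj
        (fun _ hF hne => hφ.normalizedWeightFun_image hF hne) i

theorem mainTheorem6 {V W : Type*} [Fintype V] [DecidableEq V] [Fintype W] [DecidableEq W]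
    (K : AbstractSimplicialComplex V) (M : AbstractSimplicialComplex W) (φ : V → W) (k : ℕ)
    (hφ : AbstractSimplicialComplex.IsKFoldCovering K M φ k) :
    (∀ i : ℕ, 1 ≤ i →
      AbstractSimplicialComplex.multisetSpectrum (M.combDownLaplacian i) ≤
        AbstractSimplicialComplex.multisetSpectrum (K.combDownLaplacian i)) ∧
    (∀ i : ℕ,
      AbstractSimplicialComplex.multisetSpectrum (M.normDownLaplacian i) ≤
        AbstractSimplicialComplex.multisetSpectrum (K.normDownLaplacian i)) := by
  exact mainTheorem6_general K M φ
    (SimplicialCovering.isLocalIso_of_isStrongCovering hφ.toIsStrongCovering)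
    (SimplicialCovering.surjective_of_isKFoldCovering hφ)
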